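/- Let $A, C, G, L, Q, R \in \mathbf{R}^{n\times n}$ and $M \in \mathbf{R}^{2n\times 2n}$, all independent of $\lambda$, with $Q, R, M$ symmetric positive definite, $(A,C)$ observable, $(A,GQ^{-1/2})$ controllable, $G$ and $L$ nonsingular, and $A-LC$ Schur stable (all eigenvalues of modulus less than $1$). Put $$A_e=\begin{bmatrix}A & LC\\ 0 & A-LC\end{bmatrix},\quad G_e=\begin{bmatrix}0 & L\\ G & -L\end{bmatrix},\quad C_e=\begin{bmatrix}C & C\end{bmatrix},$$ and, for $\lambda\in(0,1)$, $Q_e=\left(\frac{1-\lambda}{\lambda}M+\mathrm{diag}(Q^{-1},0)\right)^{-1}$. Consider the Riccati recursion $$\Phi_{T}=G_eQ_eG_e^{\mathrm T}+A_e\Phi_{T-1}A_e^{\mathrm T}-A_e\Phi_{T-1}C_e^{\mathrm T}(R+C_e\Phi_{T-1}C_e^{\mathrm T})^{-1}C_e\Phi_{T-1}A_e^{\mathrm T}.$$ Then for every $\lambda\in(0,1)$ the recursion has exactly one positive semidefinite fixed point $\Phi_\infty=\Phi_\infty(\lambda)$, its steady-state solution; it is positive definite and is the limit of $\Phi_T$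 for every positive semidefinite initial matrix $\Phi_0$. Moreover $\lambda\mapsto\Phi_\infty(\lambda)$ is differentiable on $(0,1)$, and $\frac{d\Phi_\infty}{d\lambda}$ is positive definite for every $\lambda\in(0,1)$. -/

import Mathlib

noncomputable section

namespace MMHE

open Matrix

variable {n m p : Type*} [Fintype n] [DecidableEq n] [Fintype m] [DecidableEq m]
  [Fintype p] [DecidableEq p]

/-- A real square matrix is Schur stable: all its complex eigenvalues have modulus `< 1`. -/
def SchurStable (A : Matrix n n ℝ) : Prop :=
  ∀ μ ∈ spectrum ℂ (A.map (algebraMap ℝ ℂ)), ‖μ‖ < 1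

/-- The Kalman controllability matrix `[B, A B, …, A ^ (n - 1) B]` (blocks side by side). -/
def controllabilityMatrix (A : Matrix n n ℝ) (B : Matrix n m ℝ) :
    Matrix n (Fin (Fintype.card n) × m) ℝ :=
  Matrix.of fun i q => (A ^ (q.1 : ℕ) * B) i q.2

/-- `(A, B)` is controllable: the controllability matrix has full rank. -/
def Controllable (A : Matrix n n ℝ) (B : Matrix n m ℝ) : Prop :=
  (controllabilityMatrix A B).rank = Fintype.card n

/-- The Kalman observability matrix `[C; C A; …; C A ^ (n - 1)]` (blocks stacked). -/
def observabilityMatrix (A : Matrix n n ℝ) (C : Matrix p n ℝ) :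
    Matrix (Fin (Fintype.card n) × p) n ℝ :=
  Matrix.of fun q j => (C * A ^ (q.1 : ℕ)) q.2 j

/-- `(A, C)` is observable: the observability matrix has full rank. -/
def Observable (A : Matrix n n ℝ) (C : Matrix p n ℝ) : Prop :=
  (observabilityMatrix A C).rank = Fintype.card n

open scoped MatrixOrder in
/-- `Q ^ (-1/2)`: the positive semidefinite square root of `Q⁻¹`. -/
def invSqrt (Q : Matrix m m ℝ) : Matrix m m ℝ :=
  CFC.sqrt Q⁻¹

/-- State matrix of the augmented system with state `(x̃, e)`. -/
def augA (A : Matrix n n ℝ) (C : Matrix p n ℝ) (L : Matrix n p ℝ) : Matrix (n ⊕ n) (n ⊕ n) ℝ :=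
  fromBlocks A (L * C) 0 (A - L * C)

/-- Noise input matrix of the augmented system with noise `(w, ν)`. -/
def augG (G : Matrix n m ℝ) (L : Matrix n p ℝ) : Matrix (n ⊕ n) (m ⊕ p) ℝ :=
  fromBlocks 0 L G (-L)

/-- Output matrix of the augmented system. -/
def augC (C : Matrix p n ℝ) : Matrix p (n ⊕ n) ℝ :=
  fromCols C C

/-- The matrix `Q_e`, defined through `Q_e⁻¹ = ((1 - lam) / lam) M + diag(Q⁻¹, 0)`. -/
def augQ (Q : Matrix m m ℝ) (M : Matrix (m ⊕ p) (m ⊕ p) ℝ) (lam : ℝ) :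
    Matrix (m ⊕ p) (m ⊕ p) ℝ :=
  (((1 - lam) / lam) • M + fromBlocks Q⁻¹ 0 0 0)⁻¹

/-- One step of the filter Riccati recursion with data `A, C`, measurement weight `R` and
process term `W`:
`X ↦ W + A X Aᵀ - A X Cᵀ (R + C X Cᵀ)⁻¹ C X Aᵀ`. -/
def riccatiStep (A : Matrix n n ℝ) (C : Matrix p n ℝ) (W : Matrix n n ℝ) (R : Matrix p p ℝ)
    (X : Matrix n n ℝ) : Matrix n n ℝ :=
  W + A * X * Aᵀ - A * (X * Cᵀ * (R + C * X * Cᵀ)⁻¹ * C * X) * Aᵀ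

/-- One step of the Riccati recursion of the augmented system at the parameter `lam`. -/
def augRiccati (A : Matrix n n ℝ) (C : Matrix p n ℝ) (G : Matrix n m ℝ) (L : Matrix n p ℝ)
    (Q : Matrix m m ℝ) (R : Matrix p p ℝ) (M : Matrix (m ⊕ p) (m ⊕ p) ℝ) (lam : ℝ)
    (X : Matrix (n ⊕ n) (n ⊕ n) ℝ) : Matrix (n ⊕ n) (n ⊕ n) ℝ :=
  riccatiStep (augA A C L) (augC C) (augG G L * augQ Q M lam * (augG G L)ᵀ) R X

/-- `X` is a steady-state solution of the augmented Riccati equation at `lam`: it is positive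
semidefinite and the recursion leaves it fixed. -/
def IsSteadyState (A : Matrix n n ℝ) (C : Matrix p n ℝ) (G : Matrix n m ℝ) (L : Matrix n p ℝ)
    (Q : Matrix m m ℝ) (R : Matrix p p ℝ) (M : Matrix (m ⊕ p) (m ⊕ p) ℝ) (lam : ℝ)
    (X : Matrix (n ⊕ n) (n ⊕ n) ℝ) : Prop :=
  X.PosSemidef ∧ augRiccati A C G L Q R M lam X = X

end MMHE

end

noncomputable section

namespace MMHE

open Matrix Filter Topology
open scoped MatrixOrder Kronecker

set_option linter.unusedSectionVars false

/-! ### Loewner-order estimates, limits of symmetric matrices, and Stein equations. -/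

section LoewnerOrder

variable {ι κ : Type*} [Fintype ι] [Fintype κ]

/-! Completing the square in the gain (`gainUpdate_sub_riccatiStep`) shows that the Riccati step is
the Loewner minimum, over all gains, of updates affine and monotone in `X`. Inserting a well-chosen
suboptimal gain then gives every comparison needed: monotonicity, a bound under scaling, and upper
bounds on iterates.

For the augmented system the gain `[L; 0]` leaves the block diagonal closed loop `diag(A - LC, A -
LC)`, which is stable, and `G_e` is invertible, so the noise weight `W = G_e Q_e G_eᵀ` is positive
definite. Hence the iterates from `0` increase and stay below a Stein supersolution. Their limit `P`
dominates `W` and serves as a Lyapunov matrix for its own closed loop `F`. Other iterates are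
squeezed between those from `0` and the affine iteration with gain frozen at `P`
(`exists_riccati_limit`).

For the derivative, `riccatiStep_sub_riccatiStep` gives the exact identity `Φ s - Φ t = (W s - W t)
+ F s (Φ s - Φ t) (F t)ᵀ`. Continuity of `Φ` follows from the scaling comparison, so one may divide
by `s - t`, invert the vectorized Stein operator and pass to the limit: `D = W' + F D Fᵀ`, whence `D
≥ W'`. Finally `W'` is positive definite because `Q_e' = λ⁻² Q_e M Q_e`. -/

lemma PosSemidef.transpose_eq {X : Matrix ι ι ℝ} (h : X.PosSemidef) : Xᵀ = X := by
  simpa [Matrix.IsHermitian] using h.1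

lemma PosSemidef.conj {X : Matrix ι ι ℝ} (h : X.PosSemidef) (B : Matrix κ ι ℝ) :
    (B * X * Bᵀ).PosSemidef := by
  simpa using h.mul_mul_conjTranspose_same B

lemma conj_mono {X Y : Matrix ι ι ℝ} (h : X ≤ Y) (B : Matrix κ ι ℝ) :
    B * X * Bᵀ ≤ B * Y * Bᵀ := by
  rw [Matrix.le_iff] at h ⊢
  have := PosSemidef.conj h B
  rwa [Matrix.mul_sub, Matrix.sub_mul] at this

lemma smul_le_smul_of_le {X Y : Matrix ι ι ℝ} {c : ℝ} (hc : 0 ≤ c) (h : X ≤ Y) :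
    c • X ≤ c • Y := by
  rw [Matrix.le_iff, ← smul_sub]
  exact Matrix.PosSemidef.smul h hc

lemma smul_le_smul_right {X : Matrix ι ι ℝ} {a b : ℝ} (hab : a ≤ b) (h : X.PosSemidef) :
    a • X ≤ b • X := by
  rw [Matrix.le_iff, ← sub_smul]
  exact h.smul (sub_nonneg.2 hab)

lemma dotProduct_mulVec_le {X Y : Matrix ι ι ℝ} (h : X ≤ Y) (x : ι → ℝ) :
    x ⬝ᵥ X *ᵥ x ≤ x ⬝ᵥ Y *ᵥ x := by
  have := (Matrix.le_iff.1 h).dotProduct_mulVec_nonneg x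
  simpa [Matrix.sub_mulVec, dotProduct_sub] using this

lemma tendsto_matrix_iff {α : Type*} {l : Filter α} {X : α → Matrix ι κ ℝ} {P : Matrix ι κ ℝ} :
    Tendsto X l (𝓝 P) ↔ ∀ i j, Tendsto (fun a => X a i j) l (𝓝 (P i j)) :=
  tendsto_pi_nhds.trans (forall_congr' fun _ => tendsto_pi_nhds)

lemma transpose_eq_of_tendsto {α : Type*} {l : Filter α} [l.NeBot] {X : α → Matrix ι ι ℝ}
    {P : Matrix ι ι ℝ} (hX : ∀ a, (X a)ᵀ = X a) (h : Tendsto X l (𝓝 P)) : Pᵀ = P := by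
  have h' : Tendsto (fun a => (X a)ᵀ) l (𝓝 Pᵀ) :=
    ((continuous_id.matrix_transpose).tendsto P).comp h
  simp only [hX] at h'
  exact tendsto_nhds_unique h' h

lemma posSemidef_of_tendsto {α : Type*} {l : Filter α} [l.NeBot] {X : α → Matrix ι ι ℝ}
    {P : Matrix ι ι ℝ} (hX : ∀ a, (X a).PosSemidef) (h : Tendsto X l (𝓝 P)) : P.PosSemidef := by
  refine Matrix.PosSemidef.of_dotProduct_mulVec_nonneg ?_ fun x => ?_
  · simpa [Matrix.IsHermitian] using transpose_eq_of_tendsto (fun a => PosSemidef.transpose_eq (hX a)) h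
  · have hc : Continuous fun Z : Matrix ι ι ℝ => star x ⬝ᵥ Z *ᵥ x :=
      continuous_const.dotProduct (continuous_id.matrix_mulVec continuous_const)
    exact ge_of_tendsto' ((hc.tendsto P).comp h) fun a => (hX a).dotProduct_mulVec_nonneg x

lemma le_of_tendsto_right {α : Type*} {l : Filter α} [l.NeBot] {X : α → Matrix ι ι ℝ}
    {P Y : Matrix ι ι ℝ} (hX : ∀ a, X a ≤ Y) (h : Tendsto X l (𝓝 P)) : P ≤ Y :=
  posSemidef_of_tendsto (X := fun a => Y - X a) (fun a => hX a) (tendsto_const_nhds.sub h)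

variable [DecidableEq ι]

/-- Lets limits and bounds of quadratic forms, which the Loewner order controls, be transferred to
entries. -/
lemma apply_eq_polarization {X : Matrix ι ι ℝ} (hX : Xᵀ = X) (i j : ι) :
    X i j = ((Pi.single i 1 + Pi.single j 1) ⬝ᵥ X *ᵥ (Pi.single i 1 + Pi.single j 1)
      - Pi.single i 1 ⬝ᵥ X *ᵥ Pi.single i 1 - Pi.single j 1 ⬝ᵥ X *ᵥ Pi.single j 1) / 2 := by
  have : X j i = X i j := congrFun (congrFun hX i) j
  simp [Matrix.mulVec_add, add_dotProduct, this]
  ring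

lemma tendsto_of_quadraticForm {α : Type*} {l : Filter α} {X : α → Matrix ι ι ℝ}
    {P : Matrix ι ι ℝ} (hX : ∀ᶠ a in l, (X a)ᵀ = X a) (hP : Pᵀ = P)
    (h : ∀ x : ι → ℝ, Tendsto (fun a => x ⬝ᵥ X a *ᵥ x) l (𝓝 (x ⬝ᵥ P *ᵥ x))) :
    Tendsto X l (𝓝 P) := by
  refine tendsto_matrix_iff.2 fun i j => ?_
  rw [apply_eq_polarization hP i j]
  exact ((((h _).sub (h _)).sub (h _)).div_const 2).congr'
    (hX.mono fun a ha => (apply_eq_polarization ha i j).symm)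

lemma quadraticForm_tendsto {α : Type*} {l : Filter α} {X : α → Matrix ι ι ℝ}
    {P : Matrix ι ι ℝ} (h : Tendsto X l (𝓝 P)) (x : ι → ℝ) :
    Tendsto (fun a => x ⬝ᵥ X a *ᵥ x) l (𝓝 (x ⬝ᵥ P *ᵥ x)) := by
  have hc : Continuous fun Z : Matrix ι ι ℝ => x ⬝ᵥ Z *ᵥ x :=
    continuous_const.dotProduct (continuous_id.matrix_mulVec continuous_const)
  exact (hc.tendsto P).comp h

lemma tendsto_of_loewner_squeeze {α : Type*} {l : Filter α} {X Lo Up : α → Matrix ι ι ℝ}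
    {P : Matrix ι ι ℝ} (hX : ∀ᶠ a in l, (X a)ᵀ = X a) (hP : Pᵀ = P)
    (hLo : ∀ᶠ a in l, Lo a ≤ X a) (hUp : ∀ᶠ a in l, X a ≤ Up a)
    (hLoP : Tendsto Lo l (𝓝 P)) (hUpP : Tendsto Up l (𝓝 P)) : Tendsto X l (𝓝 P) :=
  tendsto_of_quadraticForm hX hP fun x =>
    tendsto_of_tendsto_of_tendsto_of_le_of_le' (quadraticForm_tendsto hLoP x)
      (quadraticForm_tendsto hUpP x) (hLo.mono fun _ h => dotProduct_mulVec_le h x)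
      (hUp.mono fun _ h => dotProduct_mulVec_le h x)

lemma exists_tendsto_of_monotone {X : ℕ → Matrix ι ι ℝ} {Y : Matrix ι ι ℝ}
    (hX : ∀ k, (X k)ᵀ = X k) (hmono : ∀ k, X k ≤ X (k + 1)) (hY : ∀ k, X k ≤ Y) :
    ∃ P, Tendsto X atTop (𝓝 P) := by
  have hq : ∀ x : ι → ℝ, ∃ c, Tendsto (fun k => x ⬝ᵥ X k *ᵥ x) atTop (𝓝 c) := fun x =>
    ⟨_, tendsto_atTop_ciSup (monotone_nat_of_le_succ fun k => dotProduct_mulVec_le (hmono k) x)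
      ⟨x ⬝ᵥ Y *ᵥ x, by rintro _ ⟨k, rfl⟩; exact dotProduct_mulVec_le (hY k) x⟩⟩
  choose q hq using hq
  refine ⟨Matrix.of fun i j => (q (Pi.single i 1 + Pi.single j 1) - q (Pi.single i 1)
    - q (Pi.single j 1)) / 2, tendsto_matrix_iff.2 fun i j => ?_⟩
  simp_rw [fun a => apply_eq_polarization (hX a) i j]
  exact (((hq _).sub (hq _)).sub (hq _)).div_const 2

lemma le_sum_abs_smul_one {E : Matrix ι ι ℝ} (hE : Eᵀ = E) :
    E ≤ (∑ i, ∑ j, |E i j|) • (1 : Matrix ι ι ℝ) := by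
  refine Matrix.PosSemidef.of_dotProduct_mulVec_nonneg ?_ fun x => ?_
  · simp [Matrix.IsHermitian, hE]
  · simp only [star_trivial, Matrix.sub_mulVec, dotProduct_sub, Matrix.smul_mulVec,
      Matrix.one_mulVec, dotProduct_smul, sub_nonneg, smul_eq_mul]
    have hx : ∀ i, x i ^ 2 ≤ x ⬝ᵥ x := fun i => by
      rw [sq]
      exact Finset.single_le_sum (f := fun i => x i * x i) (fun i _ => mul_self_nonneg _)
        (Finset.mem_univ i)
    have hl : x ⬝ᵥ E *ᵥ x = ∑ i, ∑ j, x i * (E i j * x j) := by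
      simp only [dotProduct, Matrix.mulVec, Finset.mul_sum]
    rw [hl, Finset.sum_mul]
    simp_rw [Finset.sum_mul]
    refine Finset.sum_le_sum fun i _ => Finset.sum_le_sum fun j _ => ?_
    have h1 : x i * x j ≤ x ⬝ᵥ x ∧ -(x i * x j) ≤ x ⬝ᵥ x := by
      constructor <;> nlinarith [hx i, hx j, sq_nonneg (x i - x j), sq_nonneg (x i + x j)]
    have h2 := abs_le.2 ⟨by linarith [h1.2], h1.1⟩
    calc x i * (E i j * x j) = E i j * (x i * x j) := by ring
      _ ≤ |E i j| * |x i * x j| := by rw [← abs_mul]; exact le_abs_self _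
      _ ≤ |E i j| * (x ⬝ᵥ x) := mul_le_mul_of_nonneg_left h2 (abs_nonneg _)

/-- Factoring `S = Bᵀ B` and conjugating by `B⁻¹` reduces to `S = 1`, where the sum of absolute
entries works. The function `b` replaces a norm relative to `S`. -/
lemma exists_continuous_bound {S : Matrix ι ι ℝ} (hS : S.PosDef) :
    ∃ b : Matrix ι ι ℝ → ℝ, Continuous b ∧ b 0 = 0 ∧ (∀ E, 0 ≤ b E) ∧
      ∀ E, Eᵀ = E → E ≤ b E • S := by
  obtain ⟨B, hB⟩ := CStarAlgebra.nonneg_iff_eq_star_mul_self.mp hS.posSemidef.nonneg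
  have hBS : Bᵀ * B = S := by simpa [Matrix.star_eq_conjTranspose] using hB.symm
  have hBu : IsUnit B.det := by
    have h := (Matrix.isUnit_iff_isUnit_det _).1 hS.isUnit
    rw [← hBS, Matrix.det_mul] at h
    exact (IsUnit.mul_iff.1 h).2
  refine ⟨fun E => ∑ i, ∑ j, |(B⁻¹ᵀ * E * B⁻¹) i j|, ?_, by simp, fun E => by positivity,
    fun E hE => ?_⟩
  · have hc : Continuous fun E : Matrix ι ι ℝ => B⁻¹ᵀ * E * B⁻¹ :=
      (continuous_const.matrix_mul continuous_id).matrix_mul continuous_const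
    exact continuous_finsetSum _ fun i _ => continuous_finsetSum _ fun j _ =>
      (hc.matrix_elem i j).abs
  · have h1 : (B⁻¹ᵀ * E * B⁻¹)ᵀ = B⁻¹ᵀ * E * B⁻¹ := by
      simp [Matrix.transpose_mul, hE, Matrix.mul_assoc]
    have h2 := conj_mono (le_sum_abs_smul_one h1) Bᵀ
    have h3 : Bᵀ * B⁻¹ᵀ = 1 := by
      rw [← Matrix.transpose_mul, Matrix.nonsing_inv_mul _ hBu, Matrix.transpose_one]
    have h4 : Bᵀ * (B⁻¹ᵀ * E * B⁻¹) * Bᵀᵀ = E := by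
      rw [Matrix.transpose_transpose, Matrix.mul_assoc, Matrix.mul_assoc, Matrix.nonsing_inv_mul _ hBu,
        Matrix.mul_one, ← Matrix.mul_assoc, h3, Matrix.one_mul]
    rw [h4] at h2
    simpa [hBS] using h2

/-- Every sequence of conjugates `F ^ k * X * (F ^ k)ᵀ` vanishes in the limit as soon as `F ^ k`
does. -/
lemma tendsto_conj_pow {F : Matrix ι ι ℝ} (hF : Tendsto (fun k => F ^ k) atTop (𝓝 0))
    (X : Matrix ι ι ℝ) : Tendsto (fun k => F ^ k * X * (F ^ k)ᵀ) atTop (𝓝 0) := by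
  have hc : Continuous fun Z : Matrix ι ι ℝ => Z * X * Zᵀ :=
    (continuous_id.matrix_mul continuous_const).matrix_mul continuous_id.matrix_transpose
  have h := (hc.tendsto 0).comp hF
  rw [Matrix.transpose_zero, Matrix.mul_zero] at h
  exact h

/-- `P` is a Lyapunov matrix: since `W` dominates a positive multiple of `P`, conjugation by `F`
contracts `P` by a factor below one. -/
lemma tendsto_pow_of_conj_add_le {F P W : Matrix ι ι ℝ} (hP : P.PosDef) (hW : W.PosDef)
    (h : W + F * P * Fᵀ ≤ P) : Tendsto (fun k => F ^ k) atTop (𝓝 0) := by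
  obtain ⟨b, -, -, hb0, hb⟩ := exists_continuous_bound hW
  obtain ⟨b', -, -, hb0', hb'⟩ := exists_continuous_bound hP
  -- The added `1` gives `c ≥ 1`, so that `r = 1 - c⁻¹` lies in `[0, 1)`.
  set c := b P + 1
  have hc : 1 ≤ c := by linarith [hb0 P]
  have hcP : P ≤ c • W := (hb P (PosSemidef.transpose_eq hP.posSemidef)).trans
    (smul_le_smul_right (by simp [c]) hW.posSemidef)
  have hWP : c⁻¹ • P ≤ W := by
    have := smul_le_smul_of_le (inv_nonneg.2 (by linarith : (0:ℝ) ≤ c)) hcP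
    rwa [smul_smul, inv_mul_cancel₀ (by linarith), one_smul] at this
  set r := 1 - c⁻¹
  have hr0 : 0 ≤ r := by simpa [r] using inv_le_one_of_one_le₀ hc
  have hr1 : r < 1 := by simpa [r] using (by linarith : 0 < c)
  have hstep : F * P * Fᵀ ≤ r • P := by
    calc F * P * Fᵀ ≤ P - W := by rwa [le_sub_iff_add_le, add_comm]
      _ ≤ P - c⁻¹ • P := sub_le_sub_left hWP _
      _ = r • P := by simp [r, sub_smul]
  have hpow : ∀ k, F ^ k * P * (F ^ k)ᵀ ≤ r ^ k • P := by
    intro k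
    induction k with
    | zero => simp
    | succ k ih =>
      calc F ^ (k + 1) * P * (F ^ (k + 1))ᵀ = F * (F ^ k * P * (F ^ k)ᵀ) * Fᵀ := by
            rw [pow_succ', Matrix.transpose_mul]; simp only [Matrix.mul_assoc]
        _ ≤ F * (r ^ k • P) * Fᵀ := conj_mono ih F
        _ = r ^ k • (F * P * Fᵀ) := by simp
        _ ≤ r ^ k • (r • P) := smul_le_smul_of_le (pow_nonneg hr0 k) hstep
        _ = r ^ (k + 1) • P := by rw [smul_smul, pow_succ]
  have hone : (1 : Matrix ι ι ℝ) ≤ b' 1 • P := hb' 1 (by simp)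
  have hdiag : ∀ k i, (F ^ k * (F ^ k)ᵀ) i i ≤ b' 1 * (r ^ k * P i i) := by
    intro k i
    have h1 := (conj_mono hone (F ^ k)).trans (by
      simpa using smul_le_smul_of_le (hb0' 1) (hpow k))
    have := (Matrix.le_iff.1 h1).diag_nonneg (i := i)
    simpa using this
  refine tendsto_matrix_iff.2 fun i j => ?_
  -- A squared entry is one summand of a diagonal entry of `F ^ k * (F ^ k)ᵀ`.
  have hsq : Tendsto (fun k => ((F ^ k) i j) ^ 2) atTop (𝓝 0) := by
    refine squeeze_zero (fun k => sq_nonneg _) (fun k => le_trans ?_ (hdiag k i)) (g := fun k =>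
      b' 1 * (r ^ k * P i i)) ?_
    · rw [Matrix.mul_apply, sq]
      exact Finset.single_le_sum (f := fun j => (F ^ k) i j * (F ^ k)ᵀ j i)
        (fun j _ => mul_self_nonneg _) (Finset.mem_univ j)
    · simpa using ((tendsto_pow_atTop_nhds_zero_of_lt_one hr0 hr1).mul_const (P i i)).const_mul
        (b' 1)
  have := hsq.sqrt
  simp only [Real.sqrt_sq_eq_abs, Real.sqrt_zero] at this
  exact (tendsto_zero_iff_abs_tendsto_zero _).2 this

/-- A Stein inequality `S + F Y Fᵀ ≤ Y` has a positive semidefinite solution when `F ^ k → 0`. -/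
lemma exists_stein_supersolution {F S : Matrix ι ι ℝ}
    (hF : Tendsto (fun k => F ^ k) atTop (𝓝 0)) (hS : Sᵀ = S) :
    ∃ Y : Matrix ι ι ℝ, Y.PosSemidef ∧ S + F * Y * Fᵀ ≤ Y := by
  obtain ⟨b, hbc, hb00, hb0, hb⟩ := exists_continuous_bound (Matrix.PosDef.one (n := ι) (R := ℝ))
  obtain ⟨m, hm⟩ : ∃ m, b (F ^ m * 1 * (F ^ m)ᵀ) < 1 / 2 := by
    have := (hbc.tendsto 0).comp (tendsto_conj_pow hF 1)
    rw [hb00] at this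
    exact (this.eventually_lt_const (by norm_num : (0 : ℝ) < 1 / 2)).exists
  have hm' : F ^ m * (F ^ m)ᵀ ≤ (1 / 2 : ℝ) • (1 : Matrix ι ι ℝ) := by
    have := (hb _ (by simp)).trans (smul_le_smul_right hm.le Matrix.PosSemidef.one)
    simpa using this
  -- A truncated Neumann series suffices: conjugation by `F` shifts it, and the leftover term is at
  -- most half the identity.
  set Z := ∑ j ∈ Finset.range m, F ^ j * (F ^ j)ᵀ with hZ
  have hZpos : Z.PosSemidef := Matrix.posSemidef_sum _ fun j _ => by
    simpa using Matrix.posSemidef_self_mul_conjTranspose (F ^ j)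
  have hFZ : F * Z * Fᵀ = Z - 1 + F ^ m * (F ^ m)ᵀ := by
    have h1 : F * Z * Fᵀ = ∑ j ∈ Finset.range m, F ^ (j + 1) * (F ^ (j + 1))ᵀ := by
      rw [hZ, Matrix.mul_sum, Matrix.sum_mul]
      refine Finset.sum_congr rfl fun j _ => ?_
      rw [pow_succ', Matrix.transpose_mul]; simp only [Matrix.mul_assoc]
    have h2 := Finset.sum_range_succ' (fun j => F ^ j * (F ^ j)ᵀ) m
    rw [Finset.sum_range_succ] at h2
    rw [h1, hZ]
    simp only [pow_zero, Matrix.transpose_one, mul_one] at h2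
    rw [sub_add_eq_add_sub, h2, add_sub_cancel_right]
  -- The factor `2` compensates for the half lost to truncation.
  refine ⟨(2 * b S) • Z, hZpos.smul (by linarith [hb0 S]), ?_⟩
  calc S + F * ((2 * b S) • Z) * Fᵀ
      = S + (2 * b S) • (Z - 1 + F ^ m * (F ^ m)ᵀ) := by simp [hFZ]
    _ ≤ b S • (1 : Matrix ι ι ℝ) + (2 * b S) • (Z - 1 + (1 / 2 : ℝ) • (1 : Matrix ι ι ℝ)) :=
        add_le_add (hb S hS) (smul_le_smul_of_le (by linarith [hb0 S]) (add_le_add le_rfl hm'))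
    _ = (2 * b S) • Z := by module

/-- A solution of a Stein equation with stable `F` and positive semidefinite right-hand side
dominates that right-hand side. -/
lemma le_of_stein_eq {F D S : Matrix ι ι ℝ} (hF : Tendsto (fun k => F ^ k) atTop (𝓝 0))
    (hS : S.PosSemidef) (hD : D = S + F * D * Fᵀ) : S ≤ D := by
  -- These differences are the partial sums of the Neumann series for `D`; symmetry of `D` is
  -- obtained in the limit.
  have hk : ∀ k, (D - F ^ k * D * (F ^ k)ᵀ).PosSemidef := by
    intro k
    induction k with
    | zero => simpa using Matrix.PosSemidef.zero
    | succ k ih =>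
      have : D - F ^ (k + 1) * D * (F ^ (k + 1))ᵀ
          = S + F * (D - F ^ k * D * (F ^ k)ᵀ) * Fᵀ := by
        rw [Matrix.mul_sub, Matrix.sub_mul, ← add_sub_assoc, ← hD, pow_succ', Matrix.transpose_mul]
        simp only [Matrix.mul_assoc]
      rw [this]
      exact hS.add (PosSemidef.conj ih F)
  have h0 : D.PosSemidef := posSemidef_of_tendsto hk
    (by simpa using tendsto_const_nhds.sub (tendsto_conj_pow hF D))
  rw [Matrix.le_iff]
  have : D - S = F * D * Fᵀ := by rw [sub_eq_iff_eq_add']; exact hD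
  rw [this]
  exact PosSemidef.conj h0 F

lemma eq_zero_of_stein_eq {F D : Matrix ι ι ℝ} (hF : Tendsto (fun k => F ^ k) atTop (𝓝 0))
    (hD : D = F * D * Fᵀ) : D = 0 := by
  have hk : ∀ k, F ^ k * D * (F ^ k)ᵀ = D := by
    intro k
    induction k with
    | zero => simp
    | succ k ih =>
      calc F ^ (k + 1) * D * (F ^ (k + 1))ᵀ = F * (F ^ k * D * (F ^ k)ᵀ) * Fᵀ := by
            rw [pow_succ', Matrix.transpose_mul]; simp only [Matrix.mul_assoc]
        _ = D := by rw [ih, ← hD]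
  have := tendsto_conj_pow hF D
  simp only [hk] at this
  exact tendsto_nhds_unique tendsto_const_nhds this

end LoewnerOrder

/-! ### The Riccati step as a minimum over gains, and convergence of its iterates. -/

section Riccati

variable {ι κ : Type*} [Fintype ι] [DecidableEq ι] [Fintype κ] [DecidableEq κ]

/-- The Kalman gain `A X Cᵀ (R + C X Cᵀ)⁻¹` (predictor form). -/
def kalmanGain (A : Matrix ι ι ℝ) (C : Matrix κ ι ℝ) (R : Matrix κ κ ℝ) (X : Matrix ι ι ℝ) :
    Matrix ι κ ℝ :=
  A * X * Cᵀ * (R + C * X * Cᵀ)⁻¹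

/-- The closed-loop matrix of the filter with the gain computed from `X`. -/
def closedLoop (A : Matrix ι ι ℝ) (C : Matrix κ ι ℝ) (R : Matrix κ κ ℝ) (X : Matrix ι ι ℝ) :
    Matrix ι ι ℝ :=
  A - kalmanGain A C R X * C

/-- The covariance update of a predictor with an arbitrary gain `K`. -/
def gainUpdate (A : Matrix ι ι ℝ) (C : Matrix κ ι ℝ) (W : Matrix ι ι ℝ) (R : Matrix κ κ ℝ)
    (K : Matrix ι κ ℝ) (X : Matrix ι ι ℝ) : Matrix ι ι ℝ :=
  W + (A - K * C) * X * (A - K * C)ᵀ + K * R * Kᵀ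

variable {A : Matrix ι ι ℝ} {C : Matrix κ ι ℝ} {W W₁ W₂ X Y : Matrix ι ι ℝ} {R : Matrix κ κ ℝ}

lemma continuousAt_inv_of_isUnit {Z : Matrix κ κ ℝ} (hZ : IsUnit Z) :
    ContinuousAt (fun Z : Matrix κ κ ℝ => Z⁻¹) Z := by
  refine continuousAt_matrix_inv Z ?_
  rw [Ring.inverse_eq_inv']
  exact continuousAt_inv₀ ((Matrix.isUnit_iff_isUnit_det _).1 hZ).ne_zero

lemma innovation_posDef (hR : R.PosDef) (hX : X.PosSemidef) : (R + C * X * Cᵀ).PosDef :=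
  hR.add_posSemidef (PosSemidef.conj hX C)

/-- Completion of the square in `K`: the Kalman gain is the minimizer, and the innovation covariance
is the Hessian weight. -/
lemma gainUpdate_sub_riccatiStep (hR : R.PosDef) (hX : X.PosSemidef) (K : Matrix ι κ ℝ) :
    gainUpdate A C W R K X - riccatiStep A C W R X
      = (K - kalmanGain A C R X) * (R + C * X * Cᵀ) * (K - kalmanGain A C R X)ᵀ := by
  have hS := innovation_posDef (C := C) hR hX
  have hdet := (Matrix.isUnit_iff_isUnit_det _).1 hS.isUnit
  have hXt : Xᵀ = X := PosSemidef.transpose_eq hX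
  have hSit := PosSemidef.transpose_eq hS.inv.posSemidef
  have hL : ∀ Z : Matrix κ ι ℝ, (R + C * X * Cᵀ) * ((R + C * X * Cᵀ)⁻¹ * Z) = Z := fun Z =>
    Matrix.mul_nonsing_inv_cancel_left _ _ hdet
  have hL' : ∀ Z : Matrix κ ι ℝ, (R + C * X * Cᵀ)⁻¹ * ((R + C * X * Cᵀ) * Z) = Z := fun Z =>
    Matrix.nonsing_inv_mul_cancel_left _ _ hdet
  have hR' : R = (R + C * X * Cᵀ) - C * X * Cᵀ := by abel
  unfold gainUpdate riccatiStep kalmanGain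
  generalize hSd : R + C * X * Cᵀ = S at *
  rw [hR']
  simp only [Matrix.transpose_sub, Matrix.transpose_mul, hXt, hSit, Matrix.transpose_transpose,
    Matrix.mul_sub, Matrix.sub_mul, Matrix.mul_assoc, hL, hL']
  abel

lemma riccatiStep_le_gainUpdate (hR : R.PosDef) (hX : X.PosSemidef) (K : Matrix ι κ ℝ) :
    riccatiStep A C W R X ≤ gainUpdate A C W R K X := by
  rw [Matrix.le_iff, gainUpdate_sub_riccatiStep hR hX]
  exact PosSemidef.conj (innovation_posDef hR hX).posSemidef _

lemma gainUpdate_kalmanGain (hR : R.PosDef) (hX : X.PosSemidef) :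
    gainUpdate A C W R (kalmanGain A C R X) X = riccatiStep A C W R X := by
  rw [← sub_eq_zero, gainUpdate_sub_riccatiStep hR hX]
  simp

lemma gainUpdate_mono (K : Matrix ι κ ℝ) (h : X ≤ Y) :
    gainUpdate A C W R K X ≤ gainUpdate A C W R K Y :=
  add_le_add (add_le_add le_rfl (conj_mono h _)) le_rfl

lemma add_conj_closedLoop_le_riccatiStep (hR : R.PosDef) (hX : X.PosSemidef) :
    W + closedLoop A C R X * X * (closedLoop A C R X)ᵀ ≤ riccatiStep A C W R X := by
  rw [← gainUpdate_kalmanGain hR hX]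
  exact le_add_of_nonneg_right (PosSemidef.conj hR.posSemidef _).nonneg

lemma le_riccatiStep (hR : R.PosDef) (hX : X.PosSemidef) : W ≤ riccatiStep A C W R X :=
  (le_add_of_nonneg_right (PosSemidef.conj hX _).nonneg).trans
    (add_conj_closedLoop_le_riccatiStep hR hX)

lemma riccatiStep_posSemidef (hR : R.PosDef) (hW : W.PosSemidef) (hX : X.PosSemidef) :
    (riccatiStep A C W R X).PosSemidef :=
  Matrix.nonneg_iff_posSemidef.1 (hW.nonneg.trans (le_riccatiStep hR hX))

/-- The gain optimal for `Y` is merely admissible for `X`, and for a fixed gain the update is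
monotone. -/
lemma riccatiStep_mono (hR : R.PosDef) (hX : X.PosSemidef) (hY : Y.PosSemidef) (h : X ≤ Y) :
    riccatiStep A C W R X ≤ riccatiStep A C W R Y :=
  ((riccatiStep_le_gainUpdate hR hX (kalmanGain A C R Y)).trans (gainUpdate_mono _ h)).trans_eq
    (gainUpdate_kalmanGain hR hY)

lemma riccatiStep_mono_noise (h : W₁ ≤ W₂) :
    riccatiStep A C W₁ R X ≤ riccatiStep A C W₂ R X := by
  rw [Matrix.le_iff] at h ⊢
  have : riccatiStep A C W₂ R X - riccatiStep A C W₁ R X = W₂ - W₁ := by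
    unfold riccatiStep; abel
  rwa [this]

/-- With the gain of `X` kept, every term scales by `c` except the one in `R`, which is smaller than
its scaled version. -/
lemma riccatiStep_smul_le {c : ℝ} (hc : 1 ≤ c) (hR : R.PosDef) (hX : X.PosSemidef) :
    riccatiStep A C (c • W) R (c • X) ≤ c • riccatiStep A C W R X := by
  refine (riccatiStep_le_gainUpdate hR (hX.smul (by linarith)) (kalmanGain A C R X)).trans ?_
  rw [← gainUpdate_kalmanGain hR hX, gainUpdate, gainUpdate, smul_add, smul_add]
  refine add_le_add (add_le_add le_rfl (by simp)) ?_
  have := smul_le_smul_right hc (PosSemidef.conj hR.posSemidef (kalmanGain A C R X))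
  rwa [one_smul] at this

/-- An exact identity without quadratic remainder, at the cost of mixing the closed loops of `X` and
`Y`. It linearizes the dependence on the noise weight. -/
lemma riccatiStep_sub_riccatiStep (hR : R.PosDef) (hX : X.PosSemidef) (hY : Y.PosSemidef) :
    riccatiStep A C W₁ R X - riccatiStep A C W₂ R Y
      = (W₁ - W₂) + closedLoop A C R X * (X - Y) * (closedLoop A C R Y)ᵀ := by
  have hSX := innovation_posDef (C := C) hR hX
  have hSY := innovation_posDef (C := C) hR hY
  have hdX := (Matrix.isUnit_iff_isUnit_det _).1 hSX.isUnit
  have hdY := (Matrix.isUnit_iff_isUnit_det _).1 hSY.isUnit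
  have hYt : Yᵀ = Y := PosSemidef.transpose_eq hY
  have hSYt := PosSemidef.transpose_eq hSY.inv.posSemidef
  have key : C * X * Cᵀ = (R + C * X * Cᵀ) - (R + C * Y * Cᵀ) + C * Y * Cᵀ := by abel
  unfold riccatiStep closedLoop kalmanGain
  generalize R + C * X * Cᵀ = S at *
  generalize R + C * Y * Cᵀ = T at *
  -- Trading `C X Cᵀ` for `S - T + C Y Cᵀ` brings `S` and `T` next to their inverses, where they
  -- cancel.
  have key' : ∀ Z : Matrix κ ι ℝ, C * (X * (Cᵀ * Z)) = S * Z - T * Z + C * (Y * (Cᵀ * Z)) := by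
    intro Z
    rw [← Matrix.mul_assoc, ← Matrix.mul_assoc, key]
    simp only [Matrix.sub_mul, Matrix.add_mul, Matrix.mul_assoc]
  have hS : ∀ Z : Matrix κ ι ℝ, S⁻¹ * (S * Z) = Z := fun Z =>
    Matrix.nonsing_inv_mul_cancel_left _ _ hdX
  have hT : ∀ Z : Matrix κ ι ℝ, T * (T⁻¹ * Z) = Z := fun Z =>
    Matrix.mul_nonsing_inv_cancel_left _ _ hdY
  simp only [Matrix.transpose_sub, Matrix.transpose_mul, hYt, hSYt, Matrix.transpose_transpose,
    Matrix.mul_sub, Matrix.sub_mul, Matrix.mul_assoc, key', Matrix.mul_add, hS, hT]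
  abel

lemma continuousAt_kalmanGain (hR : R.PosDef) (hX : X.PosSemidef) :
    ContinuousAt (kalmanGain A C R) X := by
  have hc : Continuous fun Z : Matrix ι ι ℝ => R + C * Z * Cᵀ := by fun_prop
  have hi : ContinuousAt (fun Z : Matrix ι ι ℝ => (R + C * Z * Cᵀ)⁻¹) X :=
    ContinuousAt.comp (f := fun Z : Matrix ι ι ℝ => R + C * Z * Cᵀ)
      (continuousAt_inv_of_isUnit (innovation_posDef (C := C) hR hX).isUnit) hc.continuousAt
  have hm : Continuous fun q : Matrix ι κ ℝ × Matrix κ κ ℝ => q.1 * q.2 := by fun_prop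
  have hn : Continuous fun Z : Matrix ι ι ℝ => A * Z * Cᵀ := by fun_prop
  exact ContinuousAt.comp (g := fun q : Matrix ι κ ℝ × Matrix κ κ ℝ => q.1 * q.2)
    hm.continuousAt (hn.continuousAt.prodMk hi)

lemma continuousAt_closedLoop (hR : R.PosDef) (hX : X.PosSemidef) :
    ContinuousAt (closedLoop A C R) X := by
  have hc : Continuous fun K : Matrix ι κ ℝ => A - K * C := by fun_prop
  exact ContinuousAt.comp (g := fun K : Matrix ι κ ℝ => A - K * C) hc.continuousAt
    (continuousAt_kalmanGain hR hX)

lemma riccatiStep_eq_kalmanGain :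
    riccatiStep A C W R X = W + A * X * Aᵀ - kalmanGain A C R X * (C * X * Aᵀ) := by
  simp only [riccatiStep, kalmanGain, Matrix.mul_assoc]

lemma continuousAt_riccatiStep (hR : R.PosDef) (hX : X.PosSemidef) :
    ContinuousAt (riccatiStep A C W R) X := by
  have hc : Continuous fun q : Matrix ι κ ℝ × Matrix ι ι ℝ =>
      W + A * q.2 * Aᵀ - q.1 * (C * q.2 * Aᵀ) := by fun_prop
  have : riccatiStep A C W R = (fun q : Matrix ι κ ℝ × Matrix ι ι ℝ =>
      W + A * q.2 * Aᵀ - q.1 * (C * q.2 * Aᵀ)) ∘ fun Z => (kalmanGain A C R Z, Z) := by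
    funext Z; exact riccatiStep_eq_kalmanGain
  rw [this]
  exact ContinuousAt.comp hc.continuousAt ((continuousAt_kalmanGain hR hX).prodMk continuousAt_id)

lemma iterate_posSemidef (hR : R.PosDef) (hW : W.PosSemidef) (hX : X.PosSemidef) (k : ℕ) :
    ((riccatiStep A C W R)^[k] X).PosSemidef := by
  induction k with
  | zero => exact hX
  | succ k ih => rw [Function.iterate_succ_apply']; exact riccatiStep_posSemidef hR hW ih

lemma iterate_le_iterate (hR : R.PosDef) (hW : W.PosSemidef) (hX : X.PosSemidef)
    (hY : Y.PosSemidef) (h : X ≤ Y) (k : ℕ) :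
    (riccatiStep A C W R)^[k] X ≤ (riccatiStep A C W R)^[k] Y := by
  induction k with
  | zero => exact h
  | succ k ih =>
    rw [Function.iterate_succ_apply', Function.iterate_succ_apply']
    exact riccatiStep_mono hR (iterate_posSemidef hR hW hX k) (iterate_posSemidef hR hW hY k) ih

lemma iterate_le_of_supersolution (hR : R.PosDef) (hW : W.PosSemidef) (hX : X.PosSemidef)
    (hY : Y.PosSemidef) (h : X ≤ Y) (hs : riccatiStep A C W R Y ≤ Y) (k : ℕ) :
    (riccatiStep A C W R)^[k] X ≤ Y := by
  induction k with
  | zero => exact h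
  | succ k ih =>
    rw [Function.iterate_succ_apply']
    exact (riccatiStep_mono hR (iterate_posSemidef hR hW hX k) hY ih).trans hs

lemma closedLoop_pow_tendsto_zero (hR : R.PosDef) (hW : W.PosDef) {P : Matrix ι ι ℝ}
    (hP : P.PosDef) (hfix : riccatiStep A C W R P = P) :
    Tendsto (fun k => closedLoop A C R P ^ k) atTop (𝓝 0) :=
  tendsto_pow_of_conj_add_le hP hW
    ((add_conj_closedLoop_le_riccatiStep hR hP.posSemidef).trans_eq hfix)

/-- With the gain frozen at its value for `P`, the update is affine with fixed point `P` and linear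
part conjugation by the closed loop. -/
lemma iterate_le_fixed_add (hR : R.PosDef) (hW : W.PosSemidef) {P : Matrix ι ι ℝ}
    (hP : P.PosSemidef) (hfix : riccatiStep A C W R P = P) (hX : X.PosSemidef) (k : ℕ) :
    (riccatiStep A C W R)^[k] X
      ≤ P + closedLoop A C R P ^ k * (X - P) * (closedLoop A C R P ^ k)ᵀ := by
  induction k with
  | zero => simp
  | succ k ih =>
    rw [Function.iterate_succ_apply']
    refine (riccatiStep_le_gainUpdate hR (iterate_posSemidef hR hW hX k)
      (kalmanGain A C R P)).trans ((gainUpdate_mono _ ih).trans_eq ?_)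
    have h1 : gainUpdate A C W R (kalmanGain A C R P) P = P := by
      rw [gainUpdate_kalmanGain hR hP, hfix]
    have h2 : ∀ Z, gainUpdate A C W R (kalmanGain A C R P) (P + Z)
        = gainUpdate A C W R (kalmanGain A C R P) P
          + closedLoop A C R P * Z * (closedLoop A C R P)ᵀ := by
      intro Z
      simp only [gainUpdate, closedLoop, Matrix.mul_add, Matrix.add_mul]
      abel
    rw [h2, h1, pow_succ', Matrix.transpose_mul]
    simp only [Matrix.mul_assoc]

/-- The filter Riccati equation with positive definite noise weights and a detectable pair has a
positive definite solution that attracts every positive semidefinite initial matrix. -/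
theorem exists_riccati_limit (hR : R.PosDef) (hW : W.PosDef) {K₀ : Matrix ι κ ℝ}
    (hK : Tendsto (fun k => (A - K₀ * C) ^ k) atTop (𝓝 0)) :
    ∃ P : Matrix ι ι ℝ, P.PosDef ∧ riccatiStep A C W R P = P ∧
      ∀ X : Matrix ι ι ℝ, X.PosSemidef →
        Tendsto (fun k => (riccatiStep A C W R)^[k] X) atTop (𝓝 P) := by
  have hWs := hW.posSemidef
  have hsymm : (W + K₀ * R * K₀ᵀ)ᵀ = W + K₀ * R * K₀ᵀ :=
    PosSemidef.transpose_eq (hWs.add (PosSemidef.conj hR.posSemidef K₀))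
  -- The gain `K₀` need not be optimal; it only has to yield a supersolution bounding the iterates
  -- from `0`.
  obtain ⟨Y, hY, hYle⟩ := exists_stein_supersolution hK hsymm
  have hYs : riccatiStep A C W R Y ≤ Y := by
    refine (riccatiStep_le_gainUpdate hR hY K₀).trans (le_trans (le_of_eq ?_) hYle)
    unfold gainUpdate; abel
  have h0 : (0 : Matrix ι ι ℝ).PosSemidef := Matrix.PosSemidef.zero
  have hpos := iterate_posSemidef (A := A) (C := C) hR hWs h0
  obtain ⟨P, hP⟩ := exists_tendsto_of_monotone
    (X := fun k => (riccatiStep A C W R)^[k] 0) (Y := Y)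
    (fun k => PosSemidef.transpose_eq (hpos k))
    (fun k => by
      rw [Function.iterate_succ_apply]
      exact iterate_le_iterate hR hWs h0 (riccatiStep_posSemidef hR hWs h0)
        (riccatiStep_posSemidef hR hWs h0).nonneg k)
    (iterate_le_of_supersolution hR hWs h0 hY hY.nonneg hYs)
  have hPs : P.PosSemidef := posSemidef_of_tendsto hpos hP
  have hfix : riccatiStep A C W R P = P := by
    have h1 := (continuousAt_riccatiStep (A := A) (C := C) (W := W) hR hPs).tendsto.comp hP
    have h2 := hP.comp (tendsto_add_atTop_nat 1)
    refine tendsto_nhds_unique h1 (h2.congr fun k => ?_)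
    simp only [Function.comp_apply, Function.iterate_succ_apply']
  have hPd : P.PosDef := by
    have h1 : W ≤ P := (le_riccatiStep hR hPs).trans_eq hfix
    have h2 := hW.add_posSemidef (Matrix.le_iff.1 h1)
    rwa [add_sub_cancel] at h2
  refine ⟨P, hPd, hfix, fun X hX => ?_⟩
  have hcl := closedLoop_pow_tendsto_zero hR hW hPd hfix
  refine tendsto_of_loewner_squeeze
    (Eventually.of_forall fun k => PosSemidef.transpose_eq (iterate_posSemidef hR hWs hX k))
    (PosSemidef.transpose_eq hPs)
    (Eventually.of_forall (iterate_le_iterate hR hWs h0 hX hX.nonneg))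
    (Eventually.of_forall (iterate_le_fixed_add hR hWs hPs hfix hX)) hP ?_
  simpa using tendsto_const_nhds.add (tendsto_conj_pow hcl (X - P))

end Riccati

/-! ### Continuity and differentiability of the limit in the noise weight. -/

section ParameterDependence

variable {ι κ : Type*} [Fintype ι] [DecidableEq ι] [Fintype κ] [DecidableEq κ]
variable {A : Matrix ι ι ℝ} {C : Matrix κ ι ℝ} {R : Matrix κ κ ℝ}

/-- `P` is the positive definite solution of the Riccati equation and attracts every positive
semidefinite initial matrix. -/
structure IsRiccatiLimit (A : Matrix ι ι ℝ) (C : Matrix κ ι ℝ) (W : Matrix ι ι ℝ)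
    (R : Matrix κ κ ℝ) (P : Matrix ι ι ℝ) : Prop where
  posDef : P.PosDef
  fixed : riccatiStep A C W R P = P
  tendsto : ∀ X : Matrix ι ι ℝ, X.PosSemidef →
    Tendsto (fun k => (riccatiStep A C W R)^[k] X) atTop (𝓝 P)

lemma IsRiccatiLimit.unique {W P X : Matrix ι ι ℝ} (h : IsRiccatiLimit A C W R P)
    (hX : X.PosSemidef) (hfix : riccatiStep A C W R X = X) : X = P := by
  have h1 := h.tendsto X hX
  simp only [Function.iterate_fixed hfix] at h1
  exact tendsto_nhds_unique tendsto_const_nhds h1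

/-- By the scaling bound, `c • P₂` is a supersolution for the weight `W₁`, so it dominates the
iterates from `0`. -/
lemma IsRiccatiLimit.le_smul {W₁ W₂ P₁ P₂ : Matrix ι ι ℝ} (hR : R.PosDef) (hW : W₁.PosSemidef)
    (h₁ : IsRiccatiLimit A C W₁ R P₁) (h₂ : IsRiccatiLimit A C W₂ R P₂) {c : ℝ} (hc : 1 ≤ c)
    (h : W₁ ≤ c • W₂) : P₁ ≤ c • P₂ := by
  have hP₂ := h₂.posDef.posSemidef
  have hs : riccatiStep A C W₁ R (c • P₂) ≤ c • P₂ :=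
    ((riccatiStep_mono_noise h).trans (riccatiStep_smul_le hc hR hP₂)).trans_eq (by rw [h₂.fixed])
  have hcP : (c • P₂).PosSemidef := hP₂.smul (by linarith)
  exact le_of_tendsto_right
    (iterate_le_of_supersolution hR hW Matrix.PosSemidef.zero hcP hcP.nonneg hs)
    (h₁.tendsto 0 Matrix.PosSemidef.zero)

variable {W Φ : ℝ → Matrix ι ι ℝ} {t : ℝ}

lemma continuousAt_riccatiLimit (hR : R.PosDef) (hW : ContinuousAt W t)
    (hWpos : ∀ᶠ s in 𝓝 t, (W s).PosDef)
    (hΦ : ∀ᶠ s in 𝓝 t, IsRiccatiLimit A C (W s) R (Φ s)) : ContinuousAt Φ t := by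
  have hWt := hWpos.self_of_nhds
  have hΦt := hΦ.self_of_nhds
  obtain ⟨b, hbc, hb00, hb0, hb⟩ := exists_continuous_bound hWt
  have hup : Tendsto (fun s => b (W s - W t)) (𝓝 t) (𝓝 0) := by
    have h1 : Tendsto (fun s => W s - W t) (𝓝 t) (𝓝 0) := by
      simpa using hW.tendsto.sub (tendsto_const_nhds (x := W t))
    have h2 := (hbc.tendsto 0).comp h1
    rwa [hb00] at h2
  have hlo : Tendsto (fun s => b (W t - W s)) (𝓝 t) (𝓝 0) := by
    have h1 : Tendsto (fun s => W t - W s) (𝓝 t) (𝓝 0) := by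
      simpa using (tendsto_const_nhds (x := W t)).sub hW.tendsto
    have h2 := (hbc.tendsto 0).comp h1
    rwa [hb00] at h2
  have hsymm : ∀ s, (W s).PosDef → (W s)ᵀ = W s := fun s h =>
    PosSemidef.transpose_eq h.posSemidef
  refine tendsto_of_loewner_squeeze (Lo := fun s => (1 - b (W t - W s)) • Φ t)
    (Up := fun s => (1 + b (W s - W t)) • Φ t)
    (hΦ.mono fun s h => PosSemidef.transpose_eq h.posDef.posSemidef)
    (PosSemidef.transpose_eq hΦt.posDef.posSemidef) ?_ ?_ ?_ ?_
  · filter_upwards [hWpos, hΦ, hlo.eventually_lt_const one_pos] with s hs hs' hlt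
    -- The lower bound is the comparison with `s` and `t` exchanged and factor `c⁻¹`; near `t` one
    -- has `0 < c ≤ 1`.
    set c := 1 - b (W t - W s)
    have hc0 : 0 < c := by simp only [c]; linarith
    have hc1 : 1 ≤ c⁻¹ := (one_le_inv₀ hc0).2 (by simp only [c]; linarith [hb0 (W t - W s)])
    have h1 := hb (W t - W s) (by rw [Matrix.transpose_sub, hsymm t hWt, hsymm s hs])
    have h2 : c • W t ≤ W s := by
      rw [sub_smul, one_smul]
      exact sub_le_comm.1 h1
    have h3 : W t ≤ c⁻¹ • W s := by
      have := smul_le_smul_of_le (inv_nonneg.2 hc0.le) h2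
      rwa [smul_smul, inv_mul_cancel₀ hc0.ne', one_smul] at this
    have h4 := smul_le_smul_of_le hc0.le (hΦt.le_smul hR hWt.posSemidef hs' hc1 h3)
    rwa [smul_smul, mul_inv_cancel₀ hc0.ne', one_smul] at h4
  · filter_upwards [hWpos, hΦ] with s hs hs'
    have h1 := hb (W s - W t) (by rw [Matrix.transpose_sub, hsymm t hWt, hsymm s hs])
    refine hs'.le_smul hR hs.posSemidef hΦt (by linarith [hb0 (W s - W t)]) ?_
    rw [add_smul, one_smul]
    exact sub_le_iff_le_add'.1 h1
  · simpa using ((tendsto_const_nhds (x := (1 : ℝ))).sub hlo).smul_const (Φ t)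
  · simpa using ((tendsto_const_nhds (x := (1 : ℝ))).add hup).smul_const (Φ t)

/-- This is the matrix of `D ↦ D - F D Fᵀ` on vectorized matrices; stability of `F` makes its kernel
trivial. -/
lemma isUnit_one_sub_kronecker {F : Matrix ι ι ℝ} (hF : Tendsto (fun k => F ^ k) atTop (𝓝 0)) :
    IsUnit (1 - F ⊗ₖ F) := by
  rw [← Matrix.mulVec_injective_iff_isUnit]
  refine (injective_iff_map_eq_zero (Matrix.mulVecLin (1 - F ⊗ₖ F))).2 fun v hv => ?_
  obtain ⟨D, rfl⟩ := Matrix.vec_bijective.2 v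
  rw [Matrix.mulVecLin_apply, Matrix.sub_mulVec, Matrix.one_mulVec, Matrix.kronecker_mulVec_vec,
    sub_eq_zero, Matrix.vec_inj] at hv
  rw [eq_zero_of_stein_eq hF hv, Matrix.vec_zero]

lemma tendsto_mulVec {α : Type*} {l : Filter α} {X : α → Matrix ι ι ℝ} {v : α → ι → ℝ}
    {Z : Matrix ι ι ℝ} {w : ι → ℝ} (hX : Tendsto X l (𝓝 Z)) (hv : Tendsto v l (𝓝 w)) :
    Tendsto (fun a => X a *ᵥ v a) l (𝓝 (Z *ᵥ w)) := by
  have hm : Continuous fun q : Matrix ι ι ℝ × (ι → ℝ) => q.1 *ᵥ q.2 :=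
    continuous_fst.matrix_mulVec continuous_snd
  exact (hm.tendsto (Z, w)).comp (hX.prodMk_nhds hv)

lemma tendsto_vec {α : Type*} {l : Filter α} {X : α → Matrix ι ι ℝ} {Z : Matrix ι ι ℝ}
    (hX : Tendsto X l (𝓝 Z)) : Tendsto (fun a => vec (X a)) l (𝓝 (vec Z)) :=
  tendsto_pi_nhds.2 fun ij => tendsto_matrix_iff.1 hX ij.2 ij.1

/-- The stabilizing solution of the Riccati equation is differentiable along a differentiable
family of noise weights, and its derivative is positive definite when that of the weight is. -/
theorem riccatiLimit_hasDerivAt (hR : R.PosDef) (hW : ContinuousAt W t)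
    (hWpos : ∀ᶠ s in 𝓝 t, (W s).PosDef)
    (hΦ : ∀ᶠ s in 𝓝 t, IsRiccatiLimit A C (W s) R (Φ s)) {W' : Matrix ι ι ℝ} (hW'pos : W'.PosDef)
    (hW' : Tendsto (fun s => (s - t)⁻¹ • (W s - W t)) (𝓝[≠] t) (𝓝 W')) :
    ∃ D : Matrix ι ι ℝ, D.PosDef ∧
      Tendsto (fun s => (s - t)⁻¹ • (Φ s - Φ t)) (𝓝[≠] t) (𝓝 D) := by
  have hΦt := hΦ.self_of_nhds
  have hcl := closedLoop_pow_tendsto_zero hR hWpos.self_of_nhds hΦt.posDef hΦt.fixed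
  set F : ℝ → Matrix ι ι ℝ := fun s => closedLoop A C R (Φ s) with hFdef
  have hF : Tendsto F (𝓝 t) (𝓝 (F t)) :=
    ContinuousAt.comp (g := closedLoop A C R)
      (continuousAt_closedLoop hR hΦt.posDef.posSemidef)
      (continuousAt_riccatiLimit hR hW hWpos hΦ)
  set T : ℝ → Matrix (ι × ι) (ι × ι) ℝ := fun s => 1 - F t ⊗ₖ F s with hTdef
  have hTt : IsUnit (T t) := isUnit_one_sub_kronecker hcl
  have hT : Tendsto T (𝓝 t) (𝓝 (T t)) := by
    have hc : Continuous fun Z : Matrix ι ι ℝ => 1 - F t ⊗ₖ Z :=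
      continuous_const.sub (continuous_matrix fun i j =>
        continuous_const.mul (continuous_id.matrix_elem _ _))
    exact (hc.tendsto (F t)).comp hF
  have hTu : ∀ᶠ s in 𝓝 t, IsUnit (T s) := by
    have h1 : Tendsto (fun s => (T s).det) (𝓝 t) (𝓝 (T t).det) :=
      ((continuous_id.matrix_det).tendsto (T t)).comp hT
    have h2 := h1.eventually_ne ((Matrix.isUnit_iff_isUnit_det _).1 hTt).ne_zero
    exact h2.mono fun s hs => (Matrix.isUnit_iff_isUnit_det _).2 (isUnit_iff_ne_zero.2 hs)
  have hTinv : Tendsto (fun s => (T s)⁻¹) (𝓝 t) (𝓝 (T t)⁻¹) :=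
    (continuousAt_inv_of_isUnit hTt).tendsto.comp hT
  -- At `s = t` both sides vanish, so the full neighbourhood may be used.
  have hstein : ∀ᶠ s in 𝓝 t, T s *ᵥ vec ((s - t)⁻¹ • (Φ s - Φ t))
      = vec ((s - t)⁻¹ • (W s - W t)) := by
    filter_upwards [hΦ] with s hs
    have h1 := riccatiStep_sub_riccatiStep (A := A) (C := C) (W₁ := W s) (W₂ := W t) hR
      hs.posDef.posSemidef hΦt.posDef.posSemidef
    rw [hs.fixed, hΦt.fixed] at h1
    rw [Matrix.sub_mulVec, Matrix.one_mulVec, Matrix.kronecker_mulVec_vec, ← Matrix.vec_sub,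
      Matrix.vec_inj, Matrix.mul_smul, Matrix.smul_mul, ← smul_sub]
    congr 1
    rw [sub_eq_iff_eq_add]
    exact h1
  have hsolve : ∀ᶠ s in 𝓝 t, vec ((s - t)⁻¹ • (Φ s - Φ t))
      = (T s)⁻¹ *ᵥ vec ((s - t)⁻¹ • (W s - W t)) := by
    filter_upwards [hstein, hTu] with s hs hu
    rw [← hs, Matrix.mulVec_mulVec, Matrix.nonsing_inv_mul _ ((Matrix.isUnit_iff_isUnit_det _).1 hu),
      Matrix.one_mulVec]
  obtain ⟨D, hD⟩ := Matrix.vec_bijective.2 ((T t)⁻¹ *ᵥ vec W')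
  have hvec : Tendsto (fun s => vec ((s - t)⁻¹ • (Φ s - Φ t))) (𝓝[≠] t) (𝓝 (vec D)) := by
    rw [hD]
    refine Tendsto.congr' ((hsolve.filter_mono nhdsWithin_le_nhds).mono fun s hs => hs.symm) ?_
    exact tendsto_mulVec (hTinv.mono_left nhdsWithin_le_nhds) (tendsto_vec hW')
  refine ⟨D, ?_, tendsto_matrix_iff.2 fun i j => (tendsto_pi_nhds.1 hvec) (j, i)⟩
  have hDeq : D = W' + F t * D * (F t)ᵀ := by
    have h1 : T t *ᵥ vec D = vec W' := by
      rw [hD, Matrix.mulVec_mulVec,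
        Matrix.mul_nonsing_inv _ ((Matrix.isUnit_iff_isUnit_det _).1 hTt), Matrix.one_mulVec]
    rwa [Matrix.sub_mulVec, Matrix.one_mulVec, Matrix.kronecker_mulVec_vec, ← Matrix.vec_sub,
      Matrix.vec_inj, sub_eq_iff_eq_add] at h1
  have h2 := hW'pos.add_posSemidef (Matrix.le_iff.1 (le_of_stein_eq hcl hW'pos.posSemidef hDeq))
  rwa [add_sub_cancel] at h2

end ParameterDependence

/-! ### From eigenvalues to powers. -/

section SchurStability

variable {ι : Type*} [Fintype ι] [DecidableEq ι]

-- Gelfand's formula over `ℂ` gives geometric decay of the powers; real parts of entries recover the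
-- real matrix.
attribute [local instance] Matrix.linftyOpNormedRing Matrix.linftyOpNormedAlgebra in
lemma SchurStable.tendsto_pow {F : Matrix ι ι ℝ} (h : SchurStable F) :
    Tendsto (fun k => F ^ k) atTop (𝓝 0) := by
  rcases isEmpty_or_nonempty ι with hι | hι
  · exact tendsto_matrix_iff.2 fun i => isEmptyElim i
  set a : Matrix ι ι ℂ := F.map (algebraMap ℝ ℂ) with ha
  have hrad : spectralRadius ℂ a < (1 : NNReal) :=
    spectrum.spectralRadius_lt_of_forall_lt a fun z hz => by
      have := h z hz
      rwa [← NNReal.coe_lt_coe]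
  obtain ⟨r, hr, hr1⟩ := exists_between hrad
  have hev := (spectrum.pow_nnnorm_pow_one_div_tendsto_nhds_spectralRadius a).eventually_lt_const hr
  have hentry : ∀ (Z : Matrix ι ι ℂ) (i j : ι), ‖Z i j‖ ≤ ‖Z‖ := fun Z i j => by
    have h1 : ‖Z i j‖₊ ≤ ∑ j, ‖Z i j‖₊ :=
      Finset.single_le_sum (f := fun j => ‖Z i j‖₊) (fun _ _ => zero_le) (Finset.mem_univ j)
    have h2 : ∑ j, ‖Z i j‖₊ ≤ ‖Z‖₊ := by
      rw [Matrix.linfty_opNNNorm_def]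
      exact Finset.le_sup (f := fun i => ∑ j, ‖Z i j‖₊) (Finset.mem_univ i)
    exact_mod_cast h1.trans h2
  have hpow : ∀ i j, Tendsto (fun k => (a ^ k) i j) atTop (𝓝 0) := by
    intro i j
    have hr' : r ≠ ⊤ := ne_top_of_lt hr1
    lift r to NNReal using hr'
    have hr1' : r < 1 := by exact_mod_cast hr1
    refine squeeze_zero_norm' ?_
      (tendsto_pow_atTop_nhds_zero_of_lt_one r.2 (show (r : ℝ) < 1 from hr1'))
    filter_upwards [hev, eventually_gt_atTop 0] with k hk hk0
    have h1 : (‖a ^ k‖₊ : ENNReal) ≤ (r : ENNReal) ^ k := by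
      have := ENNReal.rpow_le_rpow hk.le (Nat.cast_nonneg k : (0 : ℝ) ≤ k)
      rwa [← ENNReal.rpow_mul, one_div_mul_cancel (by positivity), ENNReal.rpow_one,
        ENNReal.rpow_natCast] at this
    have h2 : ‖a ^ k‖ ≤ (r : ℝ) ^ k := by exact_mod_cast h1
    exact (hentry _ i j).trans h2
  refine tendsto_matrix_iff.2 fun i j => ?_
  have h2 := hpow i j
  have h3 := (Complex.continuous_re.tendsto _).comp h2
  refine h3.congr fun k => ?_
  have : a ^ k = (F ^ k).map (algebraMap ℝ ℂ) := by
    rw [ha, ← RingHom.mapMatrix_apply, ← map_pow, RingHom.mapMatrix_apply]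
  simp [this]

end SchurStability

/-! ### The augmented system and the derivative of `Q_e`. -/

section AugmentedSystem

variable {ι : Type*} [Fintype ι] [DecidableEq ι]

lemma tendsto_pow_fromBlocks_diagonal {F : Matrix ι ι ℝ}
    (h : Tendsto (fun k => F ^ k) atTop (𝓝 0)) :
    Tendsto (fun k => (fromBlocks F 0 0 F) ^ k) atTop (𝓝 0) := by
  have hpow : ∀ k, (fromBlocks F 0 0 F) ^ k = fromBlocks (F ^ k) 0 0 (F ^ k) := by
    intro k
    induction k with
    | zero => simp
    | succ k ih => simp [pow_succ, ih, Matrix.fromBlocks_multiply]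
  simp only [hpow]
  rw [← Matrix.fromBlocks_zero]
  have hc : Continuous fun Z : Matrix ι ι ℝ => fromBlocks Z 0 0 Z :=
    continuous_id.matrix_fromBlocks continuous_const continuous_const continuous_id
  exact (hc.tendsto 0).comp h

lemma augA_sub_gain_mul_augC (A C L : Matrix ι ι ℝ) :
    augA A C L - fromRows L 0 * augC C = fromBlocks (A - L * C) 0 0 (A - L * C) := by
  rw [augA, augC, Matrix.fromRows_mul_fromCols, sub_eq_add_neg, Matrix.fromBlocks_neg,
    Matrix.fromBlocks_add]
  simp [sub_eq_add_neg]

/-- On a kernel vector the first block row kills the second component through `L`; the second row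
then kills the first through `G`. -/
lemma isUnit_augG {G L : Matrix ι ι ℝ} (hG : IsUnit G) (hL : IsUnit L) : IsUnit (augG G L) := by
  have h1 := (Matrix.isUnit_iff_isUnit_det _).1 hG
  have h2 := (Matrix.isUnit_iff_isUnit_det _).1 hL
  refine Matrix.mulVec_injective_iff_isUnit.1 ?_
  refine (injective_iff_map_eq_zero (Matrix.mulVecLin (augG G L))).2 fun v hv => ?_
  rw [Matrix.mulVecLin_apply, augG, Matrix.fromBlocks_mulVec] at hv
  have hL0 : L *ᵥ (v ∘ Sum.inr) = 0 := by
    simpa using congrArg (fun w => w ∘ Sum.inl) hv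
  have hG0 : G *ᵥ (v ∘ Sum.inl) = 0 := by
    simpa [Matrix.neg_mulVec, hL0] using congrArg (fun w => w ∘ Sum.inr) hv
  have hr := Matrix.mulVec_injective_iff_isUnit.2 hL (hL0.trans (Matrix.mulVec_zero L).symm)
  have hl := Matrix.mulVec_injective_iff_isUnit.2 hG (hG0.trans (Matrix.mulVec_zero G).symm)
  funext i
  rcases i with i | i
  · exact congrFun hl i
  · exact congrFun hr i

/-- The inverse of `augQ`. -/
def augQInv (Q : Matrix ι ι ℝ) (M : Matrix (ι ⊕ ι) (ι ⊕ ι) ℝ) (s : ℝ) :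
    Matrix (ι ⊕ ι) (ι ⊕ ι) ℝ :=
  ((1 - s) / s) • M + fromBlocks Q⁻¹ 0 0 0

variable {Q : Matrix ι ι ℝ} {M : Matrix (ι ⊕ ι) (ι ⊕ ι) ℝ} {t : ℝ}

lemma augQInv_posDef (hQ : Q.PosDef) (hM : M.PosDef) (ht : t ∈ Set.Ioo (0 : ℝ) 1) :
    (augQInv Q M t).PosDef := by
  refine (hM.smul (div_pos (sub_pos.2 ht.2) ht.1)).add_posSemidef ?_
  -- The block matrix `diag(Q⁻¹, 0)` is the congruence of `Q⁻¹` by `[1 0]`.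
  have h := hQ.inv.posSemidef.conjTranspose_mul_mul_same
    (fromCols (1 : Matrix ι ι ℝ) (0 : Matrix ι ι ℝ))
  have h' : (fromCols (1 : Matrix ι ι ℝ) (0 : Matrix ι ι ℝ))ᴴ * Q⁻¹ *
      fromCols (1 : Matrix ι ι ℝ) (0 : Matrix ι ι ℝ) = fromBlocks Q⁻¹ 0 0 0 := by
    rw [Matrix.conjTranspose_fromCols_eq_fromRows_conjTranspose, Matrix.fromRows_mul,
      Matrix.fromRows_mul_fromCols]
    simp
  rwa [h'] at h

lemma augQ_posDef (hQ : Q.PosDef) (hM : M.PosDef) (ht : t ∈ Set.Ioo (0 : ℝ) 1) :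
    (augQ Q M t).PosDef :=
  (augQInv_posDef hQ hM ht).inv

lemma continuousAt_augQ (hQ : Q.PosDef) (hM : M.PosDef) (ht : t ∈ Set.Ioo (0 : ℝ) 1) :
    ContinuousAt (augQ Q M) t := by
  have h1 : ContinuousAt (augQInv Q M) t := by
    have h2 : ContinuousAt (fun s : ℝ => (1 - s) / s) t :=
      (continuousAt_const.sub continuousAt_id).div continuousAt_id ht.1.ne'
    have h3 : Continuous fun c : ℝ => c • M + fromBlocks Q⁻¹ 0 0 0 := by fun_prop
    exact ContinuousAt.comp (g := fun c : ℝ => c • M + fromBlocks Q⁻¹ 0 0 0) h3.continuousAt h2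
  exact ContinuousAt.comp (g := fun Z : Matrix (ι ⊕ ι) (ι ⊕ ι) ℝ => Z⁻¹)
    (continuousAt_inv_of_isUnit (augQInv_posDef hQ hM ht).isUnit) h1

/-- The resolvent identity gives the exact slope `(s t)⁻¹ Q_e(s) M Q_e(t)`, so continuity of `Q_e`
suffices. -/
lemma augQ_slope_tendsto (hQ : Q.PosDef) (hM : M.PosDef) (ht : t ∈ Set.Ioo (0 : ℝ) 1) :
    Tendsto (fun s => (s - t)⁻¹ • (augQ Q M s - augQ Q M t)) (𝓝[≠] t)
      (𝓝 ((t ^ 2)⁻¹ • (augQ Q M t * M * augQ Q M t))) := by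
  have hφ : Tendsto (fun s : ℝ => (s * t)⁻¹) (𝓝[≠] t) (𝓝 (t ^ 2)⁻¹) := by
    have : ContinuousAt (fun s : ℝ => (s * t)⁻¹) t :=
      (continuousAt_id.mul continuousAt_const).inv₀ (mul_ne_zero ht.1.ne' ht.1.ne')
    have h := this.tendsto.mono_left (nhdsWithin_le_nhds (s := {t}ᶜ))
    rwa [← sq] at h
  have hm : Continuous fun q : ℝ × Matrix (ι ⊕ ι) (ι ⊕ ι) ℝ =>
      q.1 • (q.2 * M * augQ Q M t) := by fun_prop
  have hlim := (hm.tendsto ((t ^ 2)⁻¹, augQ Q M t)).comp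
    (hφ.prodMk_nhds ((continuousAt_augQ hQ hM ht).tendsto.mono_left nhdsWithin_le_nhds))
  refine hlim.congr' ?_
  have hev : ∀ᶠ s in 𝓝[≠] t, s ∈ Set.Ioo (0 : ℝ) 1 :=
    nhdsWithin_le_nhds (isOpen_Ioo.mem_nhds ht)
  filter_upwards [hev, self_mem_nhdsWithin] with s hs hst
  have hus := (Matrix.isUnit_iff_isUnit_det _).1 (augQInv_posDef hQ hM hs).isUnit
  have hut := (Matrix.isUnit_iff_isUnit_det _).1 (augQInv_posDef hQ hM ht).isUnit
  have h1 : augQ Q M s - augQ Q M t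
      = augQ Q M s * (augQInv Q M t - augQInv Q M s) * augQ Q M t := by
    change (augQInv Q M s)⁻¹ - (augQInv Q M t)⁻¹
      = (augQInv Q M s)⁻¹ * (augQInv Q M t - augQInv Q M s) * (augQInv Q M t)⁻¹
    rw [Matrix.mul_sub, Matrix.sub_mul, Matrix.nonsing_inv_mul _ hus, Matrix.one_mul,
      Matrix.mul_assoc, Matrix.mul_nonsing_inv _ hut, Matrix.mul_one]
  have h2 : augQInv Q M t - augQInv Q M s = ((s - t) * (s * t)⁻¹) • M := by
    rw [augQInv, augQInv, add_sub_add_right_eq_sub, ← sub_smul]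
    congr 1
    have := hs.1.ne'
    have := ht.1.ne'
    field_simp
    ring
  have hne : s - t ≠ 0 := sub_ne_zero.2 hst
  simp only [Function.comp_apply]
  rw [h1, h2, Matrix.mul_smul, Matrix.smul_mul, smul_smul, inv_mul_cancel_left₀ hne]

end AugmentedSystem

end MMHE

end

/-! ### Application to the augmented system. -/

theorem corollary1 (n : ℕ) (A C G L Q R : Matrix (Fin n) (Fin n) ℝ)
    (M : Matrix (Fin n ⊕ Fin n) (Fin n ⊕ Fin n) ℝ)
    (hQ : Q.PosDef) (hR : R.PosDef) (hM : M.PosDef)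
    (hobs : MMHE.Observable A C) (hctrl : MMHE.Controllable A (G * MMHE.invSqrt Q))
    (hG : IsUnit G) (hL : IsUnit L) (hstab : MMHE.SchurStable (A - L * C)) :
    ∃ Φ : ℝ → Matrix (Fin n ⊕ Fin n) (Fin n ⊕ Fin n) ℝ, ∀ lam ∈ Set.Ioo (0 : ℝ) 1,
      -- `Φ lam` is the steady-state solution: it exists, is positive definite, is unique,
      -- and is the limit of the Riccati recursion
      MMHE.IsSteadyState A C G L Q R M lam (Φ lam) ∧
      (Φ lam).PosDef ∧
      (∀ X, MMHE.IsSteadyState A C G L Q R M lam X → X = Φ lam) ∧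
      (∀ Φ₀ : Matrix (Fin n ⊕ Fin n) (Fin n ⊕ Fin n) ℝ, Φ₀.PosSemidef →
        Filter.Tendsto (fun k : ℕ => (MMHE.augRiccati A C G L Q R M lam)^[k] Φ₀)
          Filter.atTop (nhds (Φ lam))) ∧
      -- it is differentiable in the parameter, with positive definite derivative
      ∃ D : Matrix (Fin n ⊕ Fin n) (Fin n ⊕ Fin n) ℝ,
        (∀ i j, HasDerivAt (fun l => Φ l i j) (D i j) lam) ∧ D.PosDef := by
  open MMHE Matrix Filter Topology in
  have hgain : Tendsto (fun k => (augA A C L - fromRows L 0 * augC C) ^ k) atTop (𝓝 0) := by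
    rw [augA_sub_gain_mul_augC]
    exact tendsto_pow_fromBlocks_diagonal hstab.tendsto_pow
  have hGu : IsUnit (augG G L) := isUnit_augG hG hL
  have hconj : ∀ {Z : Matrix (Fin n ⊕ Fin n) (Fin n ⊕ Fin n) ℝ}, Z.PosDef →
      (augG G L * Z * (augG G L)ᵀ).PosDef := fun hZ =>
    (Matrix.IsUnit.posDef_star_right_conjugate_iff hGu).2 hZ
  have hWpos : ∀ l ∈ Set.Ioo (0 : ℝ) 1, (augG G L * augQ Q M l * (augG G L)ᵀ).PosDef :=
    fun l hl => hconj (augQ_posDef hQ hM hl)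
  -- Putting the membership inside the existential lets choice produce a function on all of `ℝ`,
  -- with an irrelevant value off the interval.
  have hex : ∀ l, ∃ P, l ∈ Set.Ioo (0 : ℝ) 1 → IsRiccatiLimit (augA A C L) (augC C)
      (augG G L * augQ Q M l * (augG G L)ᵀ) R P := by
    intro l
    by_cases hl : l ∈ Set.Ioo (0 : ℝ) 1
    · obtain ⟨P, h1, h2, h3⟩ := exists_riccati_limit hR (hWpos l hl) hgain
      exact ⟨P, fun _ => ⟨h1, h2, h3⟩⟩
    · exact ⟨0, fun h => absurd h hl⟩
  choose Φ hΦ using hex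
  refine ⟨Φ, fun lam hlam => ?_⟩
  have hlim := hΦ lam hlam
  refine ⟨⟨hlim.posDef.posSemidef, hlim.fixed⟩, hlim.posDef,
    fun X hX => hlim.unique hX.1 hX.2, hlim.tendsto, ?_⟩
  have hnhds : ∀ᶠ l in 𝓝 lam, l ∈ Set.Ioo (0 : ℝ) 1 := isOpen_Ioo.mem_nhds hlam
  have hc : Continuous fun Z : Matrix (Fin n ⊕ Fin n) (Fin n ⊕ Fin n) ℝ =>
      augG G L * Z * (augG G L)ᵀ := by fun_prop
  have hQ' : ((lam ^ 2)⁻¹ • (augQ Q M lam * M * augQ Q M lam)).PosDef := by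
    have hq := augQ_posDef hQ hM hlam
    refine Matrix.PosDef.smul ?_ (by have := hlam.1; positivity)
    have h := (Matrix.IsUnit.posDef_star_right_conjugate_iff hq.isUnit).2 hM
    rwa [Matrix.star_eq_conjTranspose, hq.isHermitian.eq] at h
  obtain ⟨D, hD, hslope⟩ := riccatiLimit_hasDerivAt (Φ := Φ) hR
    (W := fun l => augG G L * augQ Q M l * (augG G L)ᵀ) (t := lam)
    (ContinuousAt.comp (g := fun Z => augG G L * Z * (augG G L)ᵀ) hc.continuousAt
      (continuousAt_augQ hQ hM hlam))
    (hnhds.mono hWpos) (hnhds.mono hΦ) (hconj hQ') (by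
      refine ((hc.tendsto _).comp (augQ_slope_tendsto hQ hM hlam)).congr fun s => ?_
      simp only [Function.comp_apply, Matrix.mul_smul, Matrix.smul_mul, Matrix.mul_sub,
        Matrix.sub_mul])
  refine ⟨D, fun i j => hasDerivAt_iff_tendsto_slope.2 ?_, hD⟩
  exact tendsto_matrix_iff.1 hslope i j
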